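/- Let $X$ be a (real or complex) Banach space that is hereditarily indecomposable, that is, $X$ is infinite dimensional and no closed subspace of $X$ can be written as the topological direct sum of two infinite-dimensional subspaces. Then no bounded linear operator $T : X \to X$ satisfies the Strong Distributional Chaos Criterion; that is, there is no bounded linear operator $T : X \to X$ for which there exists a constant $r > 1$ such that for every $m \in \mathbb{N}$ there is a vector $x_m \in X \setminus \{0\}$ with $$\lim_{k \to \infty} \|T^k x_m\| = 0 \qquad\text{and}\qquad \|T^i x_m\| \ge r^i \|x_m\| \quad \text{for } i = 1, 2, \dots, m.$$ -/

import Mathlib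

open Filter Topology

/-- `r` is an SDCC-constant for the bounded operator `T`: `r > 1` and for every `m` there is a
nonzero vector `x` with `‖T ^ k x‖ → 0` as `k → ∞` and `‖T ^ i x‖ ≥ r ^ i * ‖x‖` for
`i = 1, …, m`. -/
def IsSDCCConstant {𝕜 X : Type*} [RCLike 𝕜] [NormedAddCommGroup X] [NormedSpace 𝕜 X]
    (T : X →L[𝕜] X) (r : ℝ) : Prop :=
  1 < r ∧ ∀ m : ℕ, ∃ x : X, x ≠ 0 ∧
    Tendsto (fun k : ℕ => ‖(T ^ k) x‖) atTop (𝓝 0) ∧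
    ∀ i : ℕ, 1 ≤ i → i ≤ m → r ^ i * ‖x‖ ≤ ‖(T ^ i) x‖

/-- The Strong Distributional Chaos Criterion (SDCC) for a bounded operator. -/
def SatisfiesSDCC {𝕜 X : Type*} [RCLike 𝕜] [NormedAddCommGroup X] [NormedSpace 𝕜 X]
    (T : X →L[𝕜] X) : Prop :=
  ∃ r : ℝ, IsSDCCConstant T r

/-- `X` is hereditarily indecomposable: it is infinite dimensional, and no closed subspace `W` of
`X` is the topological direct sum of two infinite dimensional subspaces `Y` and `Z`. -/
structure IsHereditarilyIndecomposable (𝕜 X : Type*) [RCLike 𝕜] [NormedAddCommGroup X]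
    [NormedSpace 𝕜 X] : Prop where
  infinite_dimensional : ¬ FiniteDimensional 𝕜 X
  indecomposable : ∀ W : Submodule 𝕜 X, IsClosed (W : Set X) →
    ¬ ∃ Y Z : Submodule 𝕜 W, Submodule.IsTopCompl Y Z ∧
      ¬ FiniteDimensional 𝕜 Y ∧ ¬ FiniteDimensional 𝕜 Z

/-! The proof plays two facts about the quadratics `quadOp T z`, morally (T - z)(T - conj z),
against each other; using quadratics treats real and complex scalars alike. Growth: averaging an
SDCC vector along its orbit with weights sin((i+1)θ)/s^i shows that on each circle |z| = s, 1 < s <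
r, some `quadOp T z` is not bounded below (`IsSDCCConstant.exists_not_norm_le`). Rigidity: two
coprime operators cannot both be small on infinite-dimensional subspaces, since those subspaces
would then have positive angle. So `quadOp T z` is upper semi-Fredholm off one conjugate pair
(`exists_subset_pair`). A stability dichotomy and connectedness then make the non-injectivity points
isolated (`eventually_injective_quadOp`). In an annulus avoiding the exceptional pair, semi-Fredholm
and not bounded below means not injective. This gives infinitely many non-injectivity points in a
compact set, hence a forbidden accumulation point. -/

section UpperSemiFredholm

variable {𝕜 X : Type*} [RCLike 𝕜] [NormedAddCommGroup X] [NormedSpace 𝕜 X]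

/-! ### Upper semi-Fredholm operators -/

/-- A bounded operator is upper semi-Fredholm if it is bounded below on the common kernel of
finitely many bounded functionals. -/
def IsUpperSemiFredholm (P : X →L[𝕜] X) : Prop :=
  ∃ (S : Finset (StrongDual 𝕜 X)) (C : ℝ), ∀ x, (∀ f ∈ S, f x = 0) → ‖x‖ ≤ C * ‖P x‖

/-- In a triangular system of vectors and functionals, coefficients are controlled by the norm. -/
theorem norm_coeff_le_of_triangular {x : ℕ → X} {g : ℕ → StrongDual 𝕜 X}
    (hx : ∀ n, ‖x n‖ = 1) (hg : ∀ n, ‖g n‖ = 1) (hgx : ∀ n, g n (x n) = 1)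
    (htri : ∀ m n, m < n → g m (x n) = 0) (a : ℕ → 𝕜) (N : ℕ) (n : ℕ) (hn : n < N) :
    ‖a n‖ ≤ 2 ^ n * ‖∑ i ∈ Finset.range N, a i • x i‖ := by
  set y := ∑ i ∈ Finset.range N, a i • x i with hy
  induction n using Nat.strong_induction_on with
  | _ n ih =>
    -- `g n` kills all later vectors, so `a n` is `g n y` minus earlier terms; the bounds add up to
    -- 1 + (2^n - 1).
    have hgy : g n y = (∑ i ∈ Finset.range n, a i * g n (x i)) + a n := by
      obtain ⟨k, rfl⟩ : ∃ k, N = n + 1 + k := ⟨N - (n + 1), by omega⟩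
      rw [hy, map_sum, Finset.sum_range_add, Finset.sum_range_succ]
      have : ∑ i ∈ Finset.range k, g n (a (n + 1 + i) • x (n + 1 + i)) = 0 :=
        Finset.sum_eq_zero fun i _ => by rw [map_smul, htri _ _ (by omega), smul_zero]
      rw [this]
      simp [hgx]
    have h1 : ‖∑ i ∈ Finset.range n, a i * g n (x i)‖ ≤ ∑ i ∈ Finset.range n, 2 ^ i * ‖y‖ := by
      refine (norm_sum_le _ _).trans (Finset.sum_le_sum fun i hi => ?_)
      have hi := Finset.mem_range.1 hi
      rw [norm_mul]
      have h2 : ‖g n (x i)‖ ≤ 1 := by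
        simpa [hg, hx] using (g n).le_opNorm (x i)
      nlinarith [ih i hi (hi.trans hn), norm_nonneg (a i)]
    have h3 : ‖g n y‖ ≤ ‖y‖ := by simpa [hg] using (g n).le_opNorm y
    have h4 : a n = g n y - ∑ i ∈ Finset.range n, a i * g n (x i) := by rw [hgy]; ring
    have h5 : ∑ i ∈ Finset.range n, (2 : ℝ) ^ i = 2 ^ n - 1 := by
      rw [geom_sum_eq (by norm_num)]; norm_num
    rw [← Finset.sum_mul, h5] at h1
    calc ‖a n‖ ≤ ‖g n y‖ + ‖∑ i ∈ Finset.range n, a i * g n (x i)‖ := by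
          rw [h4]; exact norm_sub_le _ _
      _ ≤ 2 ^ n * ‖y‖ := by linarith

/-- An operator that is not upper semi-Fredholm is arbitrarily small on some infinite dimensional
subspace. -/
theorem exists_infinite_dimensional_norm_le {P : X →L[𝕜] X} (hP : ¬ IsUpperSemiFredholm P)
    {ε : ℝ} (hε : 0 < ε) :
    ∃ Y : Submodule 𝕜 X, ¬ FiniteDimensional 𝕜 Y ∧ ∀ y ∈ Y, ‖P y‖ ≤ ε * ‖y‖ := by
  -- The factor 4^(-n) beats the coefficient growth 2^n; the remaining geometric series sums to at
  -- most 2, which cancels the 1/2 in ε/2.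
  have key : ∀ (S : Finset (StrongDual 𝕜 X)) (n : ℕ), ∃ x : X, ∃ g : StrongDual 𝕜 X,
      (∀ f ∈ S, f x = 0) ∧ ‖x‖ = 1 ∧ ‖g‖ = 1 ∧ g x = 1 ∧ ‖P x‖ ≤ ε / 2 * (1 / 4) ^ n := by
    intro S n
    have hδ : 0 < ε / 2 * (1 / 4) ^ n := by positivity
    have : ∃ x, (∀ f ∈ S, f x = 0) ∧ (ε / 2 * (1 / 4) ^ n)⁻¹ * ‖P x‖ < ‖x‖ := by
      by_contra! h
      exact hP ⟨S, _, h⟩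
    obtain ⟨x, hxS, hx⟩ := this
    have hx0 : 0 < ‖x‖ := lt_of_le_of_lt (by positivity) hx
    have hu : ‖((‖x‖⁻¹ : ℝ) : 𝕜) • x‖ = 1 := by
      rw [norm_smul, RCLike.norm_ofReal, abs_of_pos (by positivity)]
      field_simp
    obtain ⟨g, hg, hgx⟩ := exists_dual_vector 𝕜 (((‖x‖⁻¹ : ℝ) : 𝕜) • x) (by
      intro h; rw [h] at hu; simp at hu)
    refine ⟨_, g, fun f hf => by rw [map_smul, hxS f hf, smul_zero], hu, hg, ?_, ?_⟩
    · rw [hgx, hu]; simp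
    · rw [map_smul, norm_smul, RCLike.norm_ofReal, abs_of_pos (by positivity)]
      rw [inv_mul_lt_iff₀ hδ] at hx
      rw [inv_mul_le_iff₀ hx0]
      linarith
  choose xf gf hS hx hg hgx hPx using key
  -- `S n` collects the functionals chosen before stage `n`, which makes the system triangular.
  let S : ℕ → Finset (StrongDual 𝕜 X) := fun n => by
    classical exact Nat.rec ∅ (fun n T => insert (gf T n) T) n
  have hSsucc : ∀ n f, f ∈ S (n + 1) ↔ f = gf (S n) n ∨ f ∈ S n := by
    classical
    intro n f
    change f ∈ insert (gf (S n) n) (S n) ↔ _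
    simp
  set x : ℕ → X := fun n => xf (S n) n
  set g : ℕ → StrongDual 𝕜 X := fun n => gf (S n) n
  have hmem : ∀ m n, m < n → g m ∈ S n := by
    intro m n h
    induction n, h using Nat.le_induction with
    | base => exact (hSsucc _ _).2 (Or.inl rfl)
    | succ n _ ih => exact (hSsucc _ _).2 (Or.inr ih)
  have hcoeff := norm_coeff_le_of_triangular (x := x) (g := g) (fun n => hx _ _) (fun n => hg _ _)
    (fun n => hgx _ _) (fun m n h => hS _ _ _ (hmem m n h))
  refine ⟨Submodule.span 𝕜 (Set.range x), ?_, ?_⟩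
  · intro hfin
    have hli : LinearIndependent 𝕜 x := by
      rw [linearIndependent_iff']
      intro s a hs i hi
      have hrep : ∑ j ∈ Finset.range (s.sup id + 1), (if j ∈ s then a j else 0) • x j = 0 := by
        rw [← hs, ← Finset.sum_subset (s₁ := s)]
        · exact Finset.sum_congr rfl fun j hj => by simp [hj]
        · intro j hj
          exact Finset.mem_range.2 (Nat.lt_succ_of_le (Finset.le_sup (f := id) hj))
        · intro j _ hj
          simp [hj]
      have := hcoeff (fun j => if j ∈ s then a j else 0) _ i
        (Nat.lt_succ_of_le (Finset.le_sup (f := id) hi))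
      rw [hrep] at this
      simpa [hi] using this
    have := (linearIndependent_span hli).finite
    exact not_finite ℕ
  · intro y hy
    obtain ⟨c, rfl⟩ := (Finsupp.mem_span_range_iff_exists_finsupp).1 hy
    have hrep : (c.sum fun i b => b • x i)
        = ∑ i ∈ Finset.range (c.support.sup id + 1), c i • x i := by
      rw [Finsupp.sum]
      refine Finset.sum_subset ?_ ?_
      · intro j hj
        exact Finset.mem_range.2 (Nat.lt_succ_of_le (Finset.le_sup (f := id) hj))
      · intro j _ hj
        simp [Finsupp.notMem_support_iff.1 hj]
    rw [hrep]
    set N := c.support.sup id + 1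
    have h1 := hcoeff c N
    set y := ∑ i ∈ Finset.range N, c i • x i
    have : ‖P y‖ ≤ ∑ i ∈ Finset.range N, (ε / 2 * ‖y‖) * (1 / 2) ^ i := by
      rw [map_sum]
      refine (norm_sum_le _ _).trans (Finset.sum_le_sum fun i hi => ?_)
      rw [map_smul, norm_smul]
      calc ‖c i‖ * ‖P (x i)‖ ≤ (2 ^ i * ‖y‖) * (ε / 2 * (1 / 4) ^ i) :=
            mul_le_mul (h1 i (Finset.mem_range.1 hi)) (hPx _ _) (norm_nonneg _) (by positivity)
        _ = (ε / 2 * ‖y‖) * (2 ^ i * (1 / 4) ^ i) := by ring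
        _ = _ := by rw [← mul_pow]; norm_num
    rw [← Finset.mul_sum] at this
    have h3 : ∑ i ∈ Finset.range N, (1 / 2 : ℝ) ^ i ≤ 2 := sum_geometric_two_le N
    have h4 : 0 ≤ ε / 2 * ‖y‖ := by positivity
    nlinarith

theorem IsUpperSemiFredholm.comp {P Q : X →L[𝕜] X} (hP : IsUpperSemiFredholm P)
    (hQ : IsUpperSemiFredholm Q) : IsUpperSemiFredholm (P * Q) := by
  classical
  obtain ⟨S, C, h⟩ := hP
  obtain ⟨S', C', h'⟩ := hQ
  refine ⟨S' ∪ S.image (fun f => f.comp Q), |C'| * C, fun x hx => ?_⟩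
  have h1 := h' x fun f hf => hx f (Finset.mem_union_left _ hf)
  have h2 := h (Q x) fun f hf =>
    hx (f.comp Q) (Finset.mem_union_right _ (Finset.mem_image_of_mem _ hf))
  calc ‖x‖ ≤ C' * ‖Q x‖ := h1
    _ ≤ |C'| * ‖Q x‖ := by gcongr; exact le_abs_self _
    _ ≤ |C'| * (C * ‖P (Q x)‖) := by gcongr
    _ = _ := by simp [mul_assoc]

theorem isUpperSemiFredholm_one : IsUpperSemiFredholm (1 : X →L[𝕜] X) :=
  ⟨∅, 1, fun x _ => by simp⟩

theorem IsUpperSemiFredholm.pow {P : X →L[𝕜] X} (hP : IsUpperSemiFredholm P) (n : ℕ) :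
    IsUpperSemiFredholm (P ^ n) := by
  induction n with
  | zero => simpa using isUpperSemiFredholm_one
  | succ n ih => rw [pow_succ]; exact ih.comp hP

/-- An upper semi-Fredholm operator is bounded below on a closed subspace that is the kernel of a
bounded operator to a finite dimensional space. -/
theorem IsUpperSemiFredholm.exists_clm {P : X →L[𝕜] X} (hP : IsUpperSemiFredholm P) :
    ∃ (S : Finset (StrongDual 𝕜 X)) (L : X →L[𝕜] (S → 𝕜)) (C : ℝ),
      ∀ x ∈ L.ker, ‖x‖ ≤ C * ‖P x‖ := by
  obtain ⟨S, C, h⟩ := hP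
  refine ⟨S, ContinuousLinearMap.pi fun f => f.1, C, fun x hx => h x fun f hf => ?_⟩
  exact congrFun (LinearMap.mem_ker.1 hx) ⟨f, hf⟩

theorem IsUpperSemiFredholm.finiteDimensional_ker {P : X →L[𝕜] X} (hP : IsUpperSemiFredholm P) :
    FiniteDimensional 𝕜 P.ker := by
  obtain ⟨S, L, C, h⟩ := hP.exists_clm
  refine FiniteDimensional.of_injective (L.toLinearMap.comp P.ker.subtype) ?_
  rw [← LinearMap.ker_eq_bot, LinearMap.ker_eq_bot']
  rintro ⟨x, hx⟩ hLx
  have := h x hLx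
  have hx : P x = 0 := hx
  rw [hx] at this
  simpa using this

/-- `L.ker` has finite codimension and closed image, and a finite-dimensional addition keeps the
range closed. -/
theorem IsUpperSemiFredholm.isClosed_range [CompleteSpace X] {P : X →L[𝕜] X}
    (hP : IsUpperSemiFredholm P) : IsClosed (P.range : Set X) := by
  obtain ⟨S, L, C, h⟩ := hP.exists_clm
  have : FiniteDimensional 𝕜 (X ⧸ L.ker) :=
    L.toLinearMap.quotKerEquivRange.symm.finiteDimensional
  refine LinearMap.isClosed_range_of_isClosed_map_of_finiteDimensional_quotient (s := L.ker) ?_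
  have hcl : IsClosed (L.ker : Set X) := L.isClosed_ker
  have : CompleteSpace L.ker := hcl.completeSpace_coe
  have hal : AntilipschitzWith C.toNNReal (P.comp L.ker.subtypeL) := by
    refine ContinuousLinearMap.antilipschitz_of_bound _ fun x => ?_
    refine (h x x.2).trans ?_
    gcongr
    · exact Real.le_coe_toNNReal C
    · rfl
  have := hal.isClosed_range (P.comp L.ker.subtypeL).uniformContinuous
  convert this using 1
  ext y
  simp

/-- Used contrapositively: failure to be bounded below becomes failure of injectivity. -/
theorem IsUpperSemiFredholm.exists_norm_le [CompleteSpace X] {P : X →L[𝕜] X}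
    (hP : IsUpperSemiFredholm P) (hinj : Function.Injective P) :
    ∃ C : ℝ, ∀ x, ‖x‖ ≤ C * ‖P x‖ := by
  obtain ⟨K, hK⟩ := P.antilipschitz_of_injective_of_isClosed_range hinj (by
    have := hP.isClosed_range
    rwa [LinearMap.coe_range] at this)
  exact ⟨K, fun x => P.bound_of_antilipschitz hK x⟩

end UpperSemiFredholm

/-! ### Subspaces and coprime operators in hereditarily indecomposable spaces -/

section

variable {𝕜 X : Type*} [RCLike 𝕜] [NormedAddCommGroup X] [NormedSpace 𝕜 X]

/-- Two closed infinite dimensional subspaces of a hereditarily indecomposable space have zero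
angle. -/
theorem IsHereditarilyIndecomposable.not_norm_le_norm_sub [CompleteSpace X]
    (hX : IsHereditarilyIndecomposable 𝕜 X) {Y Z : Submodule 𝕜 X}
    (hYc : IsClosed (Y : Set X)) (hZc : IsClosed (Z : Set X))
    (hY : ¬ FiniteDimensional 𝕜 Y) (hZ : ¬ FiniteDimensional 𝕜 Z) (c : ℝ) :
    ¬ ∀ y ∈ Y, ∀ z ∈ Z, ‖y‖ ≤ c * ‖y - z‖ := by
  intro h
  have : CompleteSpace Y := hYc.completeSpace_coe
  have : CompleteSpace Z := hZc.completeSpace_coe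
  have hc : ∀ y ∈ Y, ∀ z ∈ Z, ‖y‖ ≤ |c| * ‖y + z‖ := fun y hy z hz => by
    have := h y hy (-z) (Z.neg_mem hz)
    rw [sub_neg_eq_add] at this
    exact this.trans (by gcongr; exact le_abs_self c)
  have hYW : Y ≤ Y ⊔ Z := le_sup_left
  have hZW : Z ≤ Y ⊔ Z := le_sup_right
  have hclosed : IsClosed ((Y ⊔ Z : Submodule 𝕜 X) : Set X) := by
    let φ : Y × Z →L[𝕜] X := Y.subtypeL.coprod Z.subtypeL
    have hal : AntilipschitzWith (|c| + 1).toNNReal φ := by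
      refine ContinuousLinearMap.antilipschitz_of_bound _ fun p => ?_
      rw [Real.coe_toNNReal _ (by positivity)]
      have h1 := hc p.1 p.1.2 p.2 p.2.2
      have h2 : φ p = (p.1 : X) + p.2 := by simp [φ]
      rw [h2, Prod.norm_def, max_le_iff]
      refine ⟨h1.trans (by gcongr; linarith), ?_⟩
      have h3 : ‖(p.2 : X)‖ ≤ ‖(p.1 : X) + p.2‖ + ‖(p.1 : X)‖ := by
        simpa using norm_sub_le ((p.1 : X) + p.2) p.1
      change ‖(p.2 : X)‖ ≤ _
      linarith
    have := hal.isClosed_range φ.uniformContinuous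
    convert this using 1
    ext w
    simp [Submodule.mem_sup, φ]
  refine hX.indecomposable (Y ⊔ Z) hclosed
    ⟨Y.comap (Y ⊔ Z).subtype, Z.comap (Y ⊔ Z).subtype, ⟨⟨?_, ?_⟩, ?_⟩, ?_, ?_⟩
  · rw [Submodule.disjoint_def]
    rintro ⟨w, hw⟩ hwY hwZ
    have := h w hwY w hwZ
    simpa using this
  · rw [codisjoint_iff_le_sup]
    rintro ⟨w, hw⟩ -
    obtain ⟨y, hy, z, hz, rfl⟩ := Submodule.mem_sup.1 hw
    exact Submodule.mem_sup.2 ⟨⟨y, hYW hy⟩, hy, ⟨z, hZW hz⟩, hz, rfl⟩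
  -- The angle estimate is exactly a norm bound for the projection onto `Y` along `Z`.
  · refine AddMonoidHomClass.continuous_of_bound _ |c| fun w => ?_
    obtain ⟨w, hw⟩ := w
    obtain ⟨y, hy, z, hz, rfl⟩ := Submodule.mem_sup.1 hw
    have hsum : (⟨y + z, hw⟩ : ↥(Y ⊔ Z)) = ⟨y, hYW hy⟩ + ⟨z, hZW hz⟩ := rfl
    rw [hsum, map_add, Submodule.projection_apply_of_mem_left,
      Submodule.projection_apply_of_mem_right, add_zero]
    · exact hc y hy z hz
    · exact hz
    · exact hy
  · intro hf
    exact hY ((Submodule.comapSubtypeEquivOfLe hYW).finiteDimensional)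
  · intro hf
    exact hZ ((Submodule.comapSubtypeEquivOfLe hZW).finiteDimensional)

theorem norm_le_on_topologicalClosure {P : X →L[𝕜] X} {Y : Submodule 𝕜 X} {ε : ℝ}
    (h : ∀ y ∈ Y, ‖P y‖ ≤ ε * ‖y‖) : ∀ y ∈ Y.topologicalClosure, ‖P y‖ ≤ ε * ‖y‖ := by
  have hcl : IsClosed {y : X | ‖P y‖ ≤ ε * ‖y‖} :=
    isClosed_le P.continuous.norm (continuous_const.mul continuous_norm)
  exact fun y hy => closure_minimal h hcl hy

/-- In a hereditarily indecomposable space, of two coprime operators at least one is upper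
semi-Fredholm. -/
theorem IsHereditarilyIndecomposable.isUpperSemiFredholm_or [CompleteSpace X]
    (hX : IsHereditarilyIndecomposable 𝕜 X) {P Q A B : X →L[𝕜] X} (h : A * P + B * Q = 1) :
    IsUpperSemiFredholm P ∨ IsUpperSemiFredholm Q := by
  by_contra! hPQ
  set K := ‖A‖ + ‖B‖ + 1
  have hK : 0 < K := by positivity
  -- With this ε the small terms contribute ‖y‖/4 and ‖z‖/4; since ‖z‖ ≤ ‖y‖ + ‖y - z‖, half of ‖y‖
  -- is absorbed on the left.
  have hε : 0 < 1 / (4 * K) := by positivity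
  obtain ⟨Y, hY, hYP⟩ := exists_infinite_dimensional_norm_le hPQ.1 hε
  obtain ⟨Z, hZ, hZQ⟩ := exists_infinite_dimensional_norm_le hPQ.2 hε
  refine hX.not_norm_le_norm_sub (Y := Y.topologicalClosure) (Z := Z.topologicalClosure)
    Y.isClosed_topologicalClosure Z.isClosed_topologicalClosure
    (fun hf => hY (Submodule.finiteDimensional_of_le Y.le_topologicalClosure))
    (fun hf => hZ (Submodule.finiteDimensional_of_le Z.le_topologicalClosure))
    (2 * (K * ‖Q‖ + 1 / 4)) fun y hy z hz => ?_
  have h1 := norm_le_on_topologicalClosure hYP y hy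
  have h2 := norm_le_on_topologicalClosure hZQ z hz
  have h3 : y = A (P y) + B (Q (y - z) + Q z) := by
    have := congrArg (fun F : X →L[𝕜] X => F y) h
    simpa using this.symm
  have h4 : ‖y‖ ≤ K * (1 / (4 * K) * ‖y‖) + K * (‖Q‖ * ‖y - z‖ + 1 / (4 * K) * ‖z‖) := by
    calc ‖y‖ = ‖A (P y) + B (Q (y - z) + Q z)‖ := by rw [← h3]
      _ ≤ ‖A (P y)‖ + ‖B (Q (y - z) + Q z)‖ := norm_add_le _ _
      _ ≤ ‖A‖ * ‖P y‖ + ‖B‖ * (‖Q (y - z)‖ + ‖Q z‖) := by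
        gcongr
        · exact A.le_opNorm _
        · exact (B.le_opNorm _).trans (by gcongr; exact norm_add_le _ _)
      _ ≤ _ := by
        gcongr
        · linarith [norm_nonneg A, norm_nonneg B]
        · linarith [norm_nonneg A, norm_nonneg B]
        · exact Q.le_opNorm _
  have h5 : ‖z‖ ≤ ‖y‖ + ‖y - z‖ := by
    simpa using norm_sub_le y (y - z)
  have h6 : K * (1 / (4 * K) * ‖y‖) = ‖y‖ / 4 := by field_simp
  have h7 : K * (‖Q‖ * ‖y - z‖ + 1 / (4 * K) * ‖z‖) = K * ‖Q‖ * ‖y - z‖ + ‖z‖ / 4 := by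
    field_simp
  rw [h6, h7] at h4
  nlinarith

/-! ### Real quadratics in an operator -/

/-- The value at `T` of the real polynomial with roots `z` and its conjugate. -/
noncomputable def quadOp (T : X →L[𝕜] X) (z : ℂ) : X →L[𝕜] X :=
  T ^ 2 - ((2 * z.re : ℝ) : 𝕜) • T + ((Complex.normSq z : ℝ) : 𝕜) • 1

theorem quadOp_apply (T : X →L[𝕜] X) (z : ℂ) (x : X) :
    quadOp T z x = T (T x) - ((2 * z.re : ℝ) : 𝕜) • T x + ((Complex.normSq z : ℝ) : 𝕜) • x := by
  simp [quadOp, pow_two]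

theorem continuous_quadOp (T : X →L[𝕜] X) : Continuous (quadOp T) := by
  unfold quadOp
  have := Complex.continuous_normSq
  have := Complex.continuous_re
  have := RCLike.continuous_ofReal (K := 𝕜)
  fun_prop

theorem commute_quadOp_self (T : X →L[𝕜] X) (z : ℂ) : Commute T (quadOp T z) := by
  unfold quadOp
  refine (((Commute.refl T).pow_right 2).sub_right ((Commute.refl T).smul_right _)).add_right
    ((Commute.one_right T).smul_right _)

theorem Commute.quadOp_right {S T : X →L[𝕜] X} (h : Commute S T) (z : ℂ) :
    Commute S (quadOp T z) := by
  unfold quadOp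
  exact ((h.pow_right 2).sub_right (h.smul_right _)).add_right ((Commute.one_right S).smul_right _)

/-- Euclid's algorithm: the difference of the two quadratics is αT + β, and G(αT + β) = α² `quadOp T
z` - R. Here R is their resultant |(z - w)(z - conj w)|², nonzero under the hypotheses. -/
theorem exists_bezout_quadOp (T : X →L[𝕜] X) {z w : ℂ} (h1 : w ≠ z)
    (h2 : w ≠ (starRingEnd ℂ) z) :
    ∃ A B : X →L[𝕜] X, A * quadOp T z + B * quadOp T w = 1 ∧ Commute A T ∧ Commute B T := by
  set α : ℝ := 2 * w.re - 2 * z.re with hα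
  set β : ℝ := Complex.normSq z - Complex.normSq w with hβ
  set R : ℝ := α ^ 2 * Complex.normSq z + 2 * z.re * α * β + β ^ 2 with hR
  have hR0 : R ≠ 0 := by
    have e : R = Complex.normSq ((z - w) * (z - (starRingEnd ℂ) w)) := by
      simp only [hR, hα, hβ, Complex.normSq_apply, Complex.mul_re, Complex.mul_im, Complex.sub_re,
        Complex.sub_im, Complex.conj_re, Complex.conj_im]
      ring
    rw [e, Ne, Complex.normSq_eq_zero, mul_eq_zero, not_or, sub_eq_zero, sub_eq_zero]
    refine ⟨fun h => h1 h.symm, fun h => h2 ?_⟩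
    rw [h, Complex.conj_conj]
  set G : X →L[𝕜] X := (α : 𝕜) • T + ((-(2 * z.re) * α - β : ℝ) : 𝕜) • 1 with hG
  have hGT : Commute G T :=
    ((Commute.refl T).smul_left _).add_left ((Commute.one_left T).smul_left _)
  refine ⟨((R⁻¹ : ℝ) : 𝕜) • (((α ^ 2 : ℝ) : 𝕜) • 1 - G), ((R⁻¹ : ℝ) : 𝕜) • G, ?_,
    ((((Commute.one_left T).smul_left _).sub_left hGT).smul_left _), hGT.smul_left _⟩
  have key : (((α ^ 2 : ℝ) : 𝕜) • 1 - G) * quadOp T z + G * quadOp T w = (R : 𝕜) • 1 := by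
    ext x
    simp only [hG, add_apply, mul_apply_eq_comp,
      sub_apply, smul_apply, one_apply_eq_self,
      quadOp_apply, map_add, map_sub, map_smul]
    have e1 : Complex.normSq w = Complex.normSq z - β := by rw [hβ]; ring
    have e2 : w.re = z.re + α / 2 := by rw [hα]; ring
    rw [hR, e1, e2]
    push_cast
    module
  rw [smul_mul_assoc, smul_mul_assoc, ← smul_add, key, smul_smul, ← RCLike.ofReal_mul,
    inv_mul_cancel₀ hR0, RCLike.ofReal_one, one_smul]

end

/-! ### Hyperrange and stability of injectivity -/

section

variable {𝕜 X : Type*} [RCLike 𝕜] [NormedAddCommGroup X] [NormedSpace 𝕜 X]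

/-- The intersection of the ranges of all powers of an operator. -/
def hyperrange (P : X →L[𝕜] X) : Submodule 𝕜 X := ⨅ n : ℕ, (P ^ n).range

theorem mem_hyperrange {P : X →L[𝕜] X} {x : X} :
    x ∈ hyperrange P ↔ ∀ n : ℕ, ∃ y, (P ^ n) y = x := by
  rw [hyperrange, Submodule.mem_iInf]; rfl

theorem mem_hyperrange_of_commute {P Q : X →L[𝕜] X} (h : Commute P Q) {x : X}
    (hx : x ∈ hyperrange P) : Q x ∈ hyperrange P := by
  rw [mem_hyperrange] at hx ⊢
  intro n
  obtain ⟨y, rfl⟩ := hx n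
  refine ⟨Q y, ?_⟩
  exact congrArg (fun F : X →L[𝕜] X => F y) (h.pow_left n)

/-- On the kernel of `Q` the product `A * P` is the identity, so x = P^n A^n x for all n. -/
theorem mem_hyperrange_of_bezout {P Q A B : X →L[𝕜] X} (h : A * P + B * Q = 1)
    (hA : Commute A P) {x : X} (hx : Q x = 0) : x ∈ hyperrange P := by
  have hAP : ∀ n : ℕ, ((A * P) ^ n) x = x := by
    intro n
    induction n with
    | zero => simp
    | succ n ih =>
      have h1 := congrArg (fun F : X →L[𝕜] X => F x) h
      simp only [add_apply, mul_apply_eq_comp, one_apply_eq_self, hx, map_zero, add_zero] at h1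
      rw [pow_succ, mul_apply_eq_comp, mul_apply_eq_comp, h1, ih]
  refine mem_hyperrange.2 fun n => ⟨(A ^ n) x, ?_⟩
  rw [← mul_apply_eq_comp, ((hA.pow_pow n n).eq).symm, ← hA.mul_pow, hAP]

theorem range_pow_antitone (P : X →L[𝕜] X) {m n : ℕ} (h : m ≤ n) {x : X}
    (hx : ∃ y, (P ^ n) y = x) : ∃ y, (P ^ m) y = x := by
  obtain ⟨y, rfl⟩ := hx
  refine ⟨(P ^ (n - m)) y, ?_⟩
  rw [← mul_apply_eq_comp, ← pow_add, Nat.add_sub_cancel' h]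

/-- The subspaces ker P ∩ ran P^n decrease in a finite-dimensional space, so they stabilize at some
N. A preimage of `y` in ran P^N differs from one in ran P^n by an element of the stable kernel part,
so it lies in every range. -/
theorem IsUpperSemiFredholm.surjOn_hyperrange {P : X →L[𝕜] X} (hP : IsUpperSemiFredholm P)
    {y : X} (hy : y ∈ hyperrange P) : ∃ x ∈ hyperrange P, P x = y := by
  have := hP.finiteDimensional_ker
  let K : ℕ →o (Submodule 𝕜 P.ker)ᵒᵈ :=
    ⟨fun n => OrderDual.toDual ((P ^ n).range.comap P.ker.subtype), fun m n hmn => by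
      change (P ^ n).range.comap P.ker.subtype ≤ (P ^ m).range.comap P.ker.subtype
      exact fun x hx => range_pow_antitone P hmn hx⟩
  obtain ⟨N, hN⟩ := monotone_stabilizes_iff_artinian.2
    (inferInstance : IsArtinian 𝕜 P.ker) K
  have key : ∀ n, N ≤ n → ∀ x, P x = 0 → (∃ u, (P ^ N) u = x) → ∃ u, (P ^ n) u = x := by
    intro n hn x hx hu
    have h1 : (⟨x, hx⟩ : P.ker) ∈ (P ^ N).range.comap P.ker.subtype := hu
    have h2 : (P ^ N).range.comap P.ker.subtype = (P ^ n).range.comap P.ker.subtype := hN n hn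
    rw [h2] at h1
    exact h1
  have pre : ∀ n, ∃ x, P x = y ∧ ∃ u, (P ^ n) u = x := by
    intro n
    obtain ⟨u, hu⟩ := mem_hyperrange.1 hy (n + 1)
    refine ⟨(P ^ n) u, ?_, u, rfl⟩
    rw [← hu, pow_succ', mul_apply_eq_comp]
  obtain ⟨x, hx, hxN⟩ := pre N
  refine ⟨x, mem_hyperrange.2 fun n => ?_, hx⟩
  rcases le_total n N with hn | hn
  · exact range_pow_antitone P hn hxN
  · obtain ⟨x', hx', hxn⟩ := pre n
    obtain ⟨u, hu⟩ := hxN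
    obtain ⟨u', hu'⟩ := hxn
    obtain ⟨v, hv⟩ := key n hn (x - x') (by rw [map_sub, hx, hx', sub_self])
      (by
        obtain ⟨u'', hu''⟩ := range_pow_antitone P hn ⟨u', hu'⟩
        exact ⟨u - u'', by rw [map_sub, hu, hu'']⟩)
    exact ⟨v + u', by rw [map_add, hv, hu']; abel⟩

theorem IsUpperSemiFredholm.isClosed_hyperrange [CompleteSpace X] {P : X →L[𝕜] X}
    (hP : IsUpperSemiFredholm P) : IsClosed (hyperrange P : Set X) := by
  rw [hyperrange, Submodule.coe_iInf]
  exact isClosed_iInter fun n => (hP.pow n).isClosed_range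

/-- Operators near a bounded below operator are injective. -/
theorem injective_of_norm_sub_lt {Z : Type*} [NormedAddCommGroup Z] [NormedSpace 𝕜 Z]
    {P Q : Z →L[𝕜] X} {C : ℝ} (hC : 0 < C) (h : ∀ x, ‖x‖ ≤ C * ‖P x‖)
    (hQ : ‖Q - P‖ < C⁻¹) : Function.Injective Q := by
  refine (injective_iff_map_eq_zero Q).2 fun x hx => ?_
  by_contra hne
  have h1 : ‖P x‖ ≤ ‖Q - P‖ * ‖x‖ := by
    have := (Q - P).le_opNorm x
    rwa [sub_apply, hx, zero_sub, norm_neg] at this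
  have h2 : 0 < ‖x‖ := norm_pos_iff.2 hne
  have h3 := h x
  have h4 : ‖P x‖ < C⁻¹ * ‖x‖ := h1.trans_lt (by gcongr)
  rw [lt_inv_mul_iff₀ hC] at h4
  linarith

/-- Operators near a surjective operator with nontrivial kernel have nontrivial kernel. -/
theorem exists_not_injective_of_norm_sub_lt {Z : Type*} [NormedAddCommGroup Z] [NormedSpace 𝕜 Z]
    [CompleteSpace Z] {P : Z →L[𝕜] Z} (hs : Function.Surjective P)
    (hk : ¬ Function.Injective P) :
    ∃ δ > 0, ∀ Q : Z →L[𝕜] Z, ‖Q - P‖ < δ → ¬ Function.Injective Q := by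
  obtain ⟨e, hPe, he⟩ : ∃ e, P e = 0 ∧ e ≠ 0 := by
    by_contra! h
    exact hk ((injective_iff_map_eq_zero P).2 h)
  obtain ⟨R, hR⟩ := P.exists_nonlinearRightInverse_of_surjective (LinearMap.range_eq_top.2 hs)
  have hR' : (0 : ℝ) < (R.nnnorm : ℝ) := hR
  -- `Q` maps the ball of radius ‖e‖/2 about `e` onto a set containing a ball about `Q e`. The
  -- factor 1/3 puts 0 in that ball, giving a zero of `Q` too close to `e` to be 0.
  refine ⟨(R.nnnorm : ℝ)⁻¹ / 3, by positivity, fun Q hQ hinj => ?_⟩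
  have happ : ApproximatesLinearOn Q P Set.univ ‖Q - P‖₊ := by
    intro x _ y _
    have := (Q - P).le_opNorm (x - y)
    simpa using this
  have he' : 0 < ‖e‖ := norm_pos_iff.2 he
  have hsurj := happ.surjOn_closedBall_of_nonlinearRightInverse R (ε := ‖e‖ / 2) (b := e)
    (by positivity) (Set.subset_univ _)
  have h0 : (0 : Z) ∈ Metric.closedBall (Q e) (((R.nnnorm : ℝ)⁻¹ - ‖Q - P‖₊) * (‖e‖ / 2)) := by
    rw [Metric.mem_closedBall, dist_zero_left, coe_nnnorm]
    have h1 : ‖Q e‖ ≤ ‖Q - P‖ * ‖e‖ := by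
      have := (Q - P).le_opNorm e
      rwa [sub_apply, hPe, sub_zero] at this
    nlinarith
  obtain ⟨x, hx, hQx⟩ := hsurj h0
  have : x = 0 := hinj (by rw [hQx, map_zero])
  rw [this, Metric.mem_closedBall, dist_zero_left] at hx
  linarith

/-- The restriction of an operator to the hyperrange of a commuting one. -/
noncomputable def restrictHyperrange {P Q : X →L[𝕜] X} (h : Commute P Q) :
    hyperrange P →L[𝕜] hyperrange P :=
  (Q.comp (hyperrange P).subtypeL).codRestrict (hyperrange P)
    fun x => mem_hyperrange_of_commute h x.2

theorem norm_restrictHyperrange_sub_le {P Q : X →L[𝕜] X} (h : Commute P Q) :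
    ‖restrictHyperrange h - restrictHyperrange (Commute.refl P)‖ ≤ ‖Q - P‖ :=
  ContinuousLinearMap.opNorm_le_bound _ (norm_nonneg _) fun x => (Q - P).le_opNorm x

/-- Near an upper semi-Fredholm operator `P`, either all operators that are coprime to `P` are
injective or all operators commuting with `P` are not. -/
theorem IsUpperSemiFredholm.injective_dichotomy [CompleteSpace X] {P : X →L[𝕜] X}
    (hP : IsUpperSemiFredholm P) :
    (∃ δ > 0, ∀ Q A B : X →L[𝕜] X, A * P + B * Q = 1 → Commute A P → Commute P Q →
      ‖Q - P‖ < δ → Function.Injective Q) ∨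
    (∃ δ > 0, ∀ Q : X →L[𝕜] X, Commute P Q → ‖Q - P‖ < δ → ¬ Function.Injective Q) := by
  have : CompleteSpace (hyperrange P) := hP.isClosed_hyperrange.completeSpace_coe
  set P' := restrictHyperrange (Commute.refl P) with hP'
  have hs : Function.Surjective P' := by
    rintro ⟨y, hy⟩
    obtain ⟨x, hx, hxy⟩ := hP.surjOn_hyperrange hy
    exact ⟨⟨x, hx⟩, Subtype.ext hxy⟩
  -- On the hyperrange the restriction is onto, so both injectivity and its failure are stable.
  -- Injectivity lifts back to X because the kernel of a coprime `Q` lies in the hyperrange.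
  by_cases hi : Function.Injective P'
  · left
    obtain ⟨K, hK⟩ := P'.antilipschitz_of_injective_of_isClosed_range hi (by
      rw [hs.range_eq]; exact isClosed_univ)
    have hb : ∀ x, ‖x‖ ≤ ((K : ℝ) + 1) * ‖P' x‖ := fun x =>
      (P'.bound_of_antilipschitz hK x).trans (by gcongr; linarith)
    refine ⟨((K : ℝ) + 1)⁻¹, by positivity, fun Q A B h hA hQ hlt => ?_⟩
    have hinj := injective_of_norm_sub_lt (by positivity) hb
      ((norm_restrictHyperrange_sub_le hQ).trans_lt hlt)
    refine (injective_iff_map_eq_zero Q).2 fun x hx => ?_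
    have h1 : (⟨x, mem_hyperrange_of_bezout h hA hx⟩ : hyperrange P) = 0 :=
      hinj (by rw [map_zero]; exact Subtype.ext hx)
    exact congrArg Subtype.val h1
  · right
    obtain ⟨δ, hδ, h⟩ := exists_not_injective_of_norm_sub_lt hs hi
    refine ⟨δ, hδ, fun Q hQ hlt hinj => ?_⟩
    refine h (restrictHyperrange hQ) ((norm_restrictHyperrange_sub_le hQ).trans_lt hlt) ?_
    intro x y hxy
    exact Subtype.ext (hinj (congrArg Subtype.val hxy))

/-! ### Isolation of the non-injectivity points -/

/-- Where `quadOp T` is upper semi-Fredholm, it is injective on a punctured neighbourhood or fails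
to be injective on a whole neighbourhood. -/
theorem quadOp_eventually_dichotomy [CompleteSpace X] {T : X →L[𝕜] X} {z : ℂ}
    (hz : IsUpperSemiFredholm (quadOp T z)) :
    (∀ᶠ w in 𝓝[≠] z, Function.Injective (quadOp T w)) ∨
    (∀ᶠ w in 𝓝 z, ¬ Function.Injective (quadOp T w)) := by
  have hnear : ∀ δ > 0, ∀ᶠ w in 𝓝 z, ‖quadOp T w - quadOp T z‖ < δ := fun δ hδ => by
    have := Metric.tendsto_nhds.1 ((continuous_quadOp T).tendsto z) δ hδ
    simpa [dist_eq_norm] using this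
  have hcomm : ∀ w, Commute (quadOp T z) (quadOp T w) := fun w =>
    (commute_quadOp_self T z).symm.quadOp_right w
  rcases hz.injective_dichotomy with ⟨δ, hδ, h⟩ | ⟨δ, hδ, h⟩
  · left
    -- At the conjugate of `z` the quadratic is the same, hence not coprime; for real `z` the
    -- puncture already removes it.
    have hconj : ∀ᶠ w in 𝓝[≠] z, w ≠ (starRingEnd ℂ) z := by
      by_cases hc : (starRingEnd ℂ) z = z
      · rw [hc]; exact self_mem_nhdsWithin
      · exact (eventually_ne_nhds (Ne.symm hc)).filter_mono nhdsWithin_le_nhds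
    filter_upwards [(hnear δ hδ).filter_mono nhdsWithin_le_nhds, hconj,
      self_mem_nhdsWithin] with w hw hwc hwz
    obtain ⟨A, B, hAB, hA, -⟩ := exists_bezout_quadOp T hwz hwc
    exact h _ A B hAB (hA.quadOp_right z) (hcomm w) hw
  · right
    filter_upwards [hnear δ hδ] with w hw
    exact h _ (hcomm w) hw

/-- At a real point the quadratic is (T - R)². This supplies the point that starts the connectedness
argument. -/
theorem injective_quadOp_ofReal (T : X →L[𝕜] X) {R : ℝ} (hR : ‖T‖ < R) :
    Function.Injective (quadOp T (R : ℂ)) := by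
  have hfac : ∀ x, T x - (R : 𝕜) • x = 0 → x = 0 := by
    intro x hx
    by_contra hne
    have h1 : ‖T x‖ = R * ‖x‖ := by
      rw [sub_eq_zero.1 hx, norm_smul, RCLike.norm_ofReal,
        abs_of_pos ((norm_nonneg T).trans_lt hR)]
    have h2 := T.le_opNorm x
    have h3 : 0 < ‖x‖ := norm_pos_iff.2 hne
    nlinarith
  refine (injective_iff_map_eq_zero _).2 fun x hx => hfac x (hfac _ ?_)
  rw [← hx, quadOp_apply, map_sub, map_smul, Complex.normSq_ofReal, Complex.ofReal_re]
  push_cast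
  module

/-- In a hereditarily indecomposable space, the points `z` for which `quadOp T z` is not upper
semi-Fredholm are contained in a pair of conjugate numbers. -/
theorem IsHereditarilyIndecomposable.exists_subset_pair [CompleteSpace X]
    (hX : IsHereditarilyIndecomposable 𝕜 X) (T : X →L[𝕜] X) :
    ∃ z₀ : ℂ, ∀ w, ¬ IsUpperSemiFredholm (quadOp T w) → w = z₀ ∨ w = (starRingEnd ℂ) z₀ := by
  by_cases h : ∃ z, ¬ IsUpperSemiFredholm (quadOp T z)
  · obtain ⟨z, hz⟩ := h
    refine ⟨z, fun w hw => ?_⟩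
    by_contra! hne
    obtain ⟨A, B, hAB, -⟩ := exists_bezout_quadOp T hne.1 hne.2
    exact (hX.isUpperSemiFredholm_or hAB).elim hz hw
  · push Not at h
    exact ⟨0, fun w hw => absurd (h w) hw⟩

/-- In a hereditarily indecomposable space, the points of non-injectivity of `quadOp T` do not
accumulate where `quadOp T` is upper semi-Fredholm. -/
theorem IsHereditarilyIndecomposable.eventually_injective_quadOp [CompleteSpace X]
    (hX : IsHereditarilyIndecomposable 𝕜 X) (T : X →L[𝕜] X) {z : ℂ}
    (hz : IsUpperSemiFredholm (quadOp T z)) :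
    ∀ᶠ w in 𝓝[≠] z, Function.Injective (quadOp T w) := by
  obtain ⟨z₀, hz₀⟩ := hX.exists_subset_pair T
  set F : Set ℂ := {z₀, (starRingEnd ℂ) z₀} with hF
  have hFfin : F.Finite := Set.toFinite F
  have hgood : ∀ w ∈ Fᶜ, IsUpperSemiFredholm (quadOp T w) := fun w hw => by
    by_contra h
    exact hw (hz₀ w h)
  have hconn : IsPreconnected Fᶜ :=
    (hFfin.countable.isConnected_compl_of_one_lt_rank (by
      rw [Complex.rank_real_complex]; norm_num)).isPreconnected
  -- `U` and `V` are disjoint open sets covering the connected set `Fᶜ`, and a large real point lies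
  -- in `V`, so all of `Fᶜ` does.
  set U : Set ℂ := {w | ∀ᶠ v in 𝓝 w, ¬ Function.Injective (quadOp T v)}
  set V : Set ℂ := {w | ∀ᶠ v in 𝓝[≠] w, Function.Injective (quadOp T v)}
  have hUo : IsOpen U := isOpen_setOfPred_eventually_nhds
  have hVo : IsOpen V := isOpen_setOfPred_eventually_nhdsWithin
  have hUV : ∀ w, w ∈ U → w ∈ V → False := fun w hU hV => by
    have hU' : ∀ᶠ v in 𝓝 w, ¬ Function.Injective (quadOp T v) := hU
    have hV' : ∀ᶠ v in 𝓝[≠] w, Function.Injective (quadOp T v) := hV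
    obtain ⟨v, h1, h2⟩ := (hV'.and (hU'.filter_mono nhdsWithin_le_nhds)).exists
    exact h2 h1
  have hcover : Fᶜ ⊆ U ∪ V := fun w hw => (quadOp_eventually_dichotomy (hgood w hw)).symm
  obtain ⟨R, hR, hRF⟩ : ∃ R : ℝ, ‖T‖ < R ∧ (R : ℂ) ∈ Fᶜ := by
    refine ⟨‖T‖ + ‖z₀‖ + 1, by linarith [norm_nonneg z₀], ?_⟩
    have hn : ‖((‖T‖ + ‖z₀‖ + 1 : ℝ) : ℂ)‖ = ‖T‖ + ‖z₀‖ + 1 := by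
      rw [Complex.norm_real, Real.norm_of_nonneg (by positivity)]
    rintro (h | h) <;> rw [h] at hn
    · linarith [norm_nonneg T]
    · rw [Complex.norm_conj] at hn
      linarith [norm_nonneg T]
  have hRU : (R : ℂ) ∉ U := fun h => Eventually.self_of_nhds h (injective_quadOp_ofReal T hR)
  have hRV : (R : ℂ) ∈ V := (hcover hRF).resolve_left hRU
  have hsub : ∀ w ∈ Fᶜ, w ∈ V := fun w hw => by
    refine (hcover hw).resolve_left fun hwU => ?_
    obtain ⟨v, -, hvU, hvV⟩ := hconn U V hUo hVo hcover ⟨w, hw, hwU⟩ ⟨R, hRF, hRV⟩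
    exact hUV v hvU hvV
  -- `z` itself may belong to `F`; then nearby points of `Fᶜ`, already in `V`, rule out the second
  -- alternative.
  refine (quadOp_eventually_dichotomy hz).resolve_right fun hzU => ?_
  have h1 : ∀ᶠ w in 𝓝[≠] z, w ∈ Fᶜ := by
    have : ∀ᶠ w in 𝓝[≠] z, w ∉ F \ {z} :=
      nhdsWithin_le_nhds ((hFfin.subset Set.sdiff_subset).isClosed.isOpen_compl.mem_nhds
        fun h => h.2 rfl)
    filter_upwards [this, self_mem_nhdsWithin] with w hw hwz hwF
    exact hw ⟨hwF, hwz⟩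
  obtain ⟨w, hwU, hwF⟩ :=
    ((eventually_eventually_nhds.2 hzU).filter_mono nhdsWithin_le_nhds |>.and h1).exists
  exact hUV w hwU (hsub w hwF)

end

/-! ### Sine polynomials and the growth criterion -/

theorem integral_cos_int_mul {k : ℤ} (hk : k ≠ 0) :
    ∫ θ in (0 : ℝ)..Real.pi, Real.cos (k * θ) = 0 := by
  have hk' : (k : ℝ) ≠ 0 := by exact_mod_cast hk
  rw [intervalIntegral.integral_comp_mul_left (fun t => Real.cos t) hk', integral_cos]
  simp [Real.sin_int_mul_pi]

theorem integral_sin_mul_sin_nat (i m : ℕ) :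
    ∫ θ in (0 : ℝ)..Real.pi, Real.sin ((i + 1) * θ) * Real.sin ((m + 1) * θ)
      = if i = m then Real.pi / 2 else 0 := by
  have h1 : ∀ θ : ℝ, Real.sin ((i + 1) * θ) * Real.sin ((m + 1) * θ)
      = Real.cos (((i - m : ℤ) : ℝ) * θ) / 2 - Real.cos (((i + m + 2 : ℤ) : ℝ) * θ) / 2 := by
    intro θ
    have e1 : ((i - m : ℤ) : ℝ) * θ = (i + 1) * θ - (m + 1) * θ := by push_cast; ring
    have e2 : ((i + m + 2 : ℤ) : ℝ) * θ = (i + 1) * θ + (m + 1) * θ := by push_cast; ring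
    rw [e1, e2, Real.cos_sub, Real.cos_add]
    ring
  have hint : ∀ k : ℝ, IntervalIntegrable (fun θ : ℝ => Real.cos (k * θ) / 2)
      MeasureTheory.volume 0 Real.pi := fun k =>
    Continuous.intervalIntegrable (by fun_prop) _ _
  simp_rw [h1]
  rw [intervalIntegral.integral_sub (hint _) (hint _), intervalIntegral.integral_div,
    intervalIntegral.integral_div, integral_cos_int_mul (k := i + m + 2) (by positivity)]
  split_ifs with h
  · subst h
    simp
  · rw [integral_cos_int_mul (by omega)]
    simp

/-- The coefficients of a sine polynomial are bounded by its sup norm. -/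
theorem abs_coeff_le_of_sine_sum_le {b : ℕ → ℝ} {N m : ℕ} (hm : m < N) {M : ℝ}
    (h : ∀ θ : ℝ, |∑ i ∈ Finset.range N, b i * Real.sin ((i + 1) * θ)| ≤ M) : |b m| ≤ 2 * M := by
  have hI : ∫ θ in (0 : ℝ)..Real.pi,
      (∑ i ∈ Finset.range N, b i * Real.sin ((i + 1) * θ)) * Real.sin ((m + 1) * θ)
      = b m * (Real.pi / 2) := by
    simp_rw [Finset.sum_mul, mul_assoc]
    rw [intervalIntegral.integral_finsetSum
      fun i _ => Continuous.intervalIntegrable (by fun_prop) _ _]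
    simp_rw [intervalIntegral.integral_const_mul, integral_sin_mul_sin_nat]
    rw [Finset.sum_eq_single m]
    · simp
    · intro i _ hi
      simp [hi]
    · intro hi
      exact absurd (Finset.mem_range.2 hm) hi
  have hb := intervalIntegral.norm_integral_le_of_norm_le_const (a := 0) (b := Real.pi) (C := M)
    (f := fun θ : ℝ =>
      (∑ i ∈ Finset.range N, b i * Real.sin ((i + 1) * θ)) * Real.sin ((m + 1) * θ)) (by
    intro θ _
    rw [norm_mul, Real.norm_eq_abs, Real.norm_eq_abs]
    nlinarith [h θ, Real.abs_sin_le_one ((m + 1) * θ), abs_nonneg (Real.sin ((m + 1) * θ)),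
      abs_nonneg (∑ i ∈ Finset.range N, b i * Real.sin ((i + 1) * θ))])
  rw [hI, sub_zero, Real.norm_eq_abs, abs_mul, abs_of_pos (by positivity : 0 < Real.pi / 2),
    abs_of_pos Real.pi_pos] at hb
  nlinarith [Real.pi_pos]

section

variable {𝕜 X : Type*} [RCLike 𝕜] [NormedAddCommGroup X] [NormedSpace 𝕜 X]

/-- For z = s e^{iθ} the weights satisfy the recurrence of the quadratic, so the sum telescopes to
boundary terms at orders 0, N and N + 1. -/
theorem quadOp_sine_sum (T : X →L[𝕜] X) {s : ℝ} (hs : s ≠ 0) (θ : ℝ) (x : X) (N : ℕ) :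
    quadOp T (s * Complex.exp (θ * Complex.I))
      (∑ i ∈ Finset.range N, ((Real.sin ((i + 1) * θ) / s ^ i : ℝ) : 𝕜) • (T ^ i) x)
    = ((s ^ 2 * Real.sin θ : ℝ) : 𝕜) • x
      - ((s ^ 2 * Real.sin ((N + 1) * θ) / s ^ N : ℝ) : 𝕜) • (T ^ N) x
      + ((s * Real.sin (N * θ) / s ^ N : ℝ) : 𝕜) • (T ^ (N + 1)) x := by
  have hre : ((s : ℂ) * Complex.exp (θ * Complex.I)).re = s * Real.cos θ := by
    rw [Complex.re_ofReal_mul, Complex.exp_ofReal_mul_I_re]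
  have hsq : Complex.normSq ((s : ℂ) * Complex.exp (θ * Complex.I)) = s ^ 2 := by
    rw [Complex.normSq_eq_norm_sq, norm_mul, Complex.norm_exp_ofReal_mul_I, Complex.norm_real,
      mul_one, Real.norm_eq_abs, sq_abs]
  induction N with
  | zero => simp
  | succ N ih =>
    have htrig : Real.sin ((N + 1 + 1) * θ)
        = 2 * Real.cos θ * Real.sin ((N + 1) * θ) - Real.sin (N * θ) := by
      have e1 : ((N : ℝ) + 1 + 1) * θ = (N + 1) * θ + θ := by ring
      have e2 : (N : ℝ) * θ = (N + 1) * θ - θ := by ring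
      rw [e1, e2, Real.sin_add, Real.sin_sub]
      ring
    have hT1 : T ((T ^ N) x) = (T ^ (N + 1)) x := by rw [pow_succ', mul_apply_eq_comp]
    have hT2 : T ((T ^ (N + 1)) x) = (T ^ (N + 1 + 1)) x := by
      rw [pow_succ' T (N + 1), mul_apply_eq_comp]
    rw [Finset.sum_range_succ, map_add, ih, map_smul, quadOp_apply, hre, hsq, hT1, hT2]
    push_cast
    rw [htrig]
    have hs' : (s : 𝕜) ≠ 0 := by exact_mod_cast hs
    match_scalars <;> field_simp <;> ring

/-- A norming functional for `y m` reduces this to the scalar sine-coefficient bound. -/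
theorem norm_le_two_mul_of_sine_sum_le {y : ℕ → X} {N m : ℕ} (hm : m < N) {M : ℝ} {s : ℝ}
    (hs : 0 < s)
    (h : ∀ θ : ℝ, ‖∑ i ∈ Finset.range N, ((Real.sin ((i + 1) * θ) / s ^ i : ℝ) : 𝕜) • y i‖ ≤ M) :
    ‖y m‖ / s ^ m ≤ 2 * M := by
  obtain ⟨g, hg, hgy⟩ := exists_dual_vector'' 𝕜 (y m)
  have hb := abs_coeff_le_of_sine_sum_le (b := fun i => RCLike.re (g (y i)) / s ^ i) hm (M := M) (by
    intro θ
    have e : ∑ i ∈ Finset.range N, RCLike.re (g (y i)) / s ^ i * Real.sin ((i + 1) * θ)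
        = RCLike.re (g (∑ i ∈ Finset.range N,
          ((Real.sin ((i + 1) * θ) / s ^ i : ℝ) : 𝕜) • y i)) := by
      rw [map_sum, map_sum]
      refine Finset.sum_congr rfl fun i _ => ?_
      rw [map_smul, smul_eq_mul, RCLike.re_ofReal_mul]
      ring
    rw [e]
    refine (RCLike.abs_re_le_norm _).trans ((g.le_opNorm _).trans ?_)
    nlinarith [h θ, norm_nonneg (∑ i ∈ Finset.range N,
          ((Real.sin ((i + 1) * θ) / s ^ i : ℝ) : 𝕜) • y i)])
  simp only [hgy, RCLike.ofReal_re] at hb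
  rwa [abs_of_nonneg (by positivity)] at hb

/-- Being bounded below is an open condition with locally uniform constant; compactness does the
rest. -/
theorem exists_uniform_norm_le {T : X →L[𝕜] X} {K : Set ℂ} (hK : IsCompact K)
    (h : ∀ z ∈ K, ∃ C : ℝ, ∀ x, ‖x‖ ≤ C * ‖quadOp T z x‖) :
    ∃ C : ℝ, ∀ z ∈ K, ∀ x, ‖x‖ ≤ C * ‖quadOp T z x‖ := by
  refine hK.induction_on (p := fun S => ∃ C : ℝ, ∀ z ∈ S, ∀ x, ‖x‖ ≤ C * ‖quadOp T z x‖)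
    ⟨0, by simp⟩ (fun S S' hS ⟨C, hC⟩ => ⟨C, fun z hz => hC z (hS hz)⟩) ?_ ?_
  · rintro S S' ⟨C, hC⟩ ⟨C', hC'⟩
    refine ⟨max C C', fun z hz x => ?_⟩
    rcases hz with hz | hz
    · exact (hC z hz x).trans (by gcongr; exact le_max_left _ _)
    · exact (hC' z hz x).trans (by gcongr; exact le_max_right _ _)
  · intro z hz
    obtain ⟨C, hC⟩ := h z hz
    have hpos : 0 < |C| + 1 := by positivity
    refine ⟨{w | ‖quadOp T w - quadOp T z‖ < 1 / (2 * (|C| + 1))}, ?_, 2 * (|C| + 1), ?_⟩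
    · have := Metric.tendsto_nhds.1 ((continuous_quadOp T).tendsto z) (1 / (2 * (|C| + 1)))
        (by positivity)
      simp only [dist_eq_norm] at this
      exact nhdsWithin_le_nhds this
    · intro w hw x
      have hw : ‖quadOp T w - quadOp T z‖ < 1 / (2 * (|C| + 1)) := hw
      have h1 : ‖quadOp T z x‖ ≤ ‖quadOp T w x‖ + 1 / (2 * (|C| + 1)) * ‖x‖ := by
        have h2 := (quadOp T w - quadOp T z).le_opNorm x
        rw [sub_apply] at h2
        have h3 : ‖quadOp T z x‖ ≤ ‖quadOp T w x‖ + ‖quadOp T w x - quadOp T z x‖ := by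
          simpa using norm_sub_le (quadOp T w x) (quadOp T w x - quadOp T z x)
        have h4 : ‖quadOp T w - quadOp T z‖ * ‖x‖ ≤ 1 / (2 * (|C| + 1)) * ‖x‖ := by gcongr
        linarith
      have h5 : ‖x‖ ≤ (|C| + 1) * ‖quadOp T z x‖ :=
        (hC x).trans (by gcongr; linarith [le_abs_self C])
      have h6 : (|C| + 1) * ‖quadOp T z x‖ ≤ (|C| + 1) * ‖quadOp T w x‖ + ‖x‖ / 2 := by
        calc _ ≤ (|C| + 1) * (‖quadOp T w x‖ + 1 / (2 * (|C| + 1)) * ‖x‖) := by gcongr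
          _ = _ := by field_simp
      linarith

/-- If `r` is an SDCC-constant, the approximate point spectrum meets every circle of radius
between `1` and `r`. -/
theorem IsSDCCConstant.exists_not_norm_le {T : X →L[𝕜] X} {r : ℝ} (hr : IsSDCCConstant T r)
    {s : ℝ} (h1s : 1 < s) (hsr : s < r) :
    ∃ z : ℂ, ‖z‖ = s ∧ ¬ ∃ C : ℝ, ∀ x, ‖x‖ ≤ C * ‖quadOp T z x‖ := by
  by_contra! hcon
  obtain ⟨C, hC⟩ := exists_uniform_norm_le (T := T) (isCompact_sphere (0 : ℂ) s)
    fun z hz => hcon z (by simpa using hz)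
  have hs0 : 0 < s := by linarith
  have hbound : ∀ m : ℕ, (r / s) ^ m ≤ 2 * (|C| * (s ^ 2 + 1)) := by
    intro m
    obtain ⟨x, hx0, hlim, hgrow⟩ := hr.2 m
    have hxpos : 0 < ‖x‖ := norm_pos_iff.2 hx0
    have hlim2 : Tendsto (fun N : ℕ => s ^ 2 * ‖(T ^ N) x‖ + s * ‖(T ^ (N + 1)) x‖) atTop
        (𝓝 0) := by
      simpa using (hlim.const_mul (s ^ 2)).add ((hlim.comp (tendsto_add_atTop_nat 1)).const_mul s)
    -- `N` is taken after `x`, so late that decay of the orbit makes the far boundary terms at most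
    -- ‖x‖; the bound is then independent of `m`.
    obtain ⟨N, hN, hmN⟩ :=
      ((hlim2.eventually_le_const hxpos).and (eventually_gt_atTop m)).exists
    have hw : ∀ θ : ℝ, ‖∑ i ∈ Finset.range N,
        ((Real.sin ((i + 1) * θ) / s ^ i : ℝ) : 𝕜) • (T ^ i) x‖ ≤ |C| * ((s ^ 2 + 1) * ‖x‖) := by
      intro θ
      have hz : (s : ℂ) * Complex.exp (θ * Complex.I) ∈ Metric.sphere (0 : ℂ) s := by
        simp [Complex.norm_exp_ofReal_mul_I, abs_of_pos hs0]
      refine (hC _ hz _).trans ?_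
      rw [quadOp_sine_sum T hs0.ne']
      refine mul_le_mul (le_abs_self C) ?_ (norm_nonneg _) (abs_nonneg C)
      have hsN : 1 ≤ s ^ N := one_le_pow₀ h1s.le
      have hcoef : ∀ (c t : ℝ), 0 ≤ c → |c * Real.sin t / s ^ N| ≤ c := fun c t hc => by
        rw [abs_div, abs_mul, abs_of_nonneg hc, abs_of_pos (by positivity : 0 < s ^ N)]
        refine (div_le_self (by positivity) hsN).trans ?_
        exact mul_le_of_le_one_right hc (Real.abs_sin_le_one t)
      have hcoef1 : |s ^ 2 * Real.sin θ| ≤ s ^ 2 := by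
        rw [abs_mul, abs_of_nonneg (by positivity : 0 ≤ s ^ 2)]
        exact mul_le_of_le_one_right (by positivity) (Real.abs_sin_le_one θ)
      refine (norm_add_le _ _).trans ((add_le_add_left (norm_sub_le _ _) _).trans ?_)
      simp only [norm_smul, RCLike.norm_ofReal]
      have t1 := mul_le_mul_of_nonneg_right hcoef1 (norm_nonneg x)
      have t2 := mul_le_mul_of_nonneg_right (hcoef (s ^ 2) ((N + 1) * θ) (by positivity))
        (norm_nonneg ((T ^ N) x))
      have t3 := mul_le_mul_of_nonneg_right (hcoef s (N * θ) hs0.le)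
        (norm_nonneg ((T ^ (N + 1)) x))
      linarith
    have h2 := norm_le_two_mul_of_sine_sum_le (𝕜 := 𝕜) hmN hs0 hw
    have h3 : r ^ m * ‖x‖ ≤ ‖(T ^ m) x‖ := by
      rcases Nat.eq_zero_or_pos m with rfl | hm
      · simp
      · exact hgrow m hm le_rfl
    have h4 : (r / s) ^ m * ‖x‖ ≤ 2 * (|C| * (s ^ 2 + 1)) * ‖x‖ := by
      calc (r / s) ^ m * ‖x‖ = r ^ m * ‖x‖ / s ^ m := by rw [div_pow]; ring
        _ ≤ ‖(T ^ m) x‖ / s ^ m := by gcongr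
        _ ≤ _ := by linarith
    exact le_of_mul_le_mul_right h4 hxpos
  obtain ⟨m, hm⟩ := pow_unbounded_of_one_lt (2 * (|C| * (s ^ 2 + 1))) ((one_lt_div hs0).2 hsr)
  exact absurd (hbound m) (not_le.2 hm)

end

/-! ### Conclusion -/

theorem corollary3p7 {𝕜 X : Type*} [RCLike 𝕜] [NormedAddCommGroup X] [NormedSpace 𝕜 X]
    [CompleteSpace X] (hX : IsHereditarilyIndecomposable 𝕜 X) (T : X →L[𝕜] X) :
    ¬ SatisfiesSDCC T := by
  rintro ⟨r, hr⟩
  obtain ⟨z₀, hz₀⟩ := hX.exists_subset_pair T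
  have h1r := hr.1
  -- The annulus is placed in the half of (1, r) away from ‖z₀‖.
  obtain ⟨a, b, h1a, hab, hbr, hz₀ab⟩ : ∃ a b : ℝ, 1 < a ∧ a < b ∧ b < r ∧ ‖z₀‖ ∉ Set.Icc a b := by
    rcases le_or_gt ‖z₀‖ ((1 + r) / 2) with h | h
    · exact ⟨(2 + 4 * r) / 6, (1 + 5 * r) / 6, by linarith, by linarith, by linarith,
        fun h' => by linarith [h'.1]⟩
    · exact ⟨(5 + r) / 6, (4 + 2 * r) / 6, by linarith, by linarith, by linarith,
        fun h' => by linarith [h'.2]⟩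
  have hgood : ∀ z : ℂ, ‖z‖ ∈ Set.Icc a b → IsUpperSemiFredholm (quadOp T z) := fun z hz => by
    by_contra h
    rcases hz₀ z h with rfl | rfl
    · exact hz₀ab hz
    · rw [Complex.norm_conj] at hz
      exact hz₀ab hz
  set S : Set ℂ := {z | ‖z‖ ∈ Set.Icc a b ∧ ¬ Function.Injective (quadOp T z)} with hS
  have hSinf : S.Infinite := by
    -- Every circle of the annulus meets `S`, so the norms of its points fill an interval.
    refine Set.Infinite.of_image (fun z => ‖z‖) ((Set.Icc_infinite hab).mono fun s hs => ?_)
    obtain ⟨z, hz, hnot⟩ := hr.exists_not_norm_le (h1a.trans_le hs.1) (hs.2.trans_lt hbr)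
    have hzs : ‖z‖ ∈ Set.Icc a b := by rw [hz]; exact hs
    exact ⟨z, ⟨hzs, fun hinj => hnot ((hgood z hzs).exists_norm_le hinj)⟩, hz⟩
  have hK : IsCompact {z : ℂ | ‖z‖ ∈ Set.Icc a b} := by
    refine (isCompact_closedBall (0 : ℂ) b).of_isClosed_subset
      (isClosed_Icc.preimage continuous_norm) fun z hz => ?_
    rw [mem_closedBall_zero_iff]
    exact hz.2
  obtain ⟨z, hz, hacc⟩ := hSinf.exists_accPt_of_subset_isCompact hK fun z hz => hz.1
  rw [accPt_iff_frequently_nhdsNE] at hacc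
  obtain ⟨w, hw, hinj⟩ := (hacc.and_eventually
    (hX.eventually_injective_quadOp T (hgood z hz))).exists
  exact hw.2 hinj
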